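/- Let $\Delta$ be a countable compact subset of $\mathbb{R}$. Put $\Delta^{(1)}$ for the set of limit points of $\Delta$, let $\Delta^{(n+1)}$ be the set of limit points of $\Delta^{(n)}$ for $n\ge 1$, and let $\Delta^{(\infty)}=\bigcap_{n\ge 1}\Delta^{(n)}$. Let $\mathbf{Z}[\mathbb{R}]$ be the family of zero sets of continuous functions on $\mathbb{R}$. A $z$-filter on $\mathbb{R}$ is a non-empty proper subset of $\mathbf{Z}[\mathbb{R}]$ that is closed under finite intersections and under supersets in $\mathbf{Z}[\mathbb{R}]$; it is a prime $z$-filter $\mathcal{P}$ if moreover $Z_1\cup Z_2\notin\mathcal{P}$ whenever $Z_1,Z_2\in\mathbf{Z}[\mathbb{R}]\setminus\mathcal{P}$. Let $\mathfrak{c}=2^{\aleph_0}$, identified with the smallest ordinal of that cardinality. Suppose that $\Delta^{(\infty)}\neq\emptyset$. Then: 1. there is a well-ordered decreasing chain of order type $\mathfrak{c}$ of prime $z$-filters on $\mathbb{R}$, each of which contains $\Delta$; that is, there is a family $(\mathcal{Q}_\alpha)_{\alpha<\mathfrak{c}}$ of prime $z$-filters on $\mathbb{R}$ with $\Delta\in\mathcal{Q}_\alpha$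 for every $\alpha<\mathfrak{c}$ and $\mathcal{Q}_\beta\subsetneq\mathcal{Q}_\alpha$ whenever $\alpha<\beta<\mathfrak{c}$; 2. there is a well-ordered increasing chain of order type $\mathfrak{c}$ of prime $z$-filters on $\mathbb{R}$, each of which contains $\Delta$; that is, there is a family $(\mathcal{Q}_\alpha)_{\alpha<\mathfrak{c}}$ of prime $z$-filters on $\mathbb{R}$ with $\Delta\in\mathcal{Q}_\alpha$ for every $\alpha<\mathfrak{c}$ and $\mathcal{Q}_\alpha\subsetneq\mathcal{Q}_\beta$ whenever $\alpha<\beta<\mathfrak{c}$. -/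

import Mathlib

/-- The family `Z[X]` of all zero sets of continuous real-valued functions on `X`. -/
def zeroSets (X : Type*) [TopologicalSpace X] : Set (Set X) :=
  {Z | ∃ f : C(X, ℝ), Z = {x | f x = 0}}

/-- A `z`-filter on `X`: a non-empty proper subset of `Z[X]` which is closed under finite
intersections and under supersets in `Z[X]`. -/
structure IsZFilter {X : Type*} [TopologicalSpace X] (F : Set (Set X)) : Prop where
  nonempty : F.Nonempty
  proper : F ⊂ zeroSets X
  inter_mem : ∀ Z₁ ∈ F, ∀ Z₂ ∈ F, Z₁ ∩ Z₂ ∈ F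
  superset_mem : ∀ Z₁ ∈ F, ∀ Z₂ ∈ zeroSets X, Z₁ ⊆ Z₂ → Z₂ ∈ F

/-- A prime `z`-filter: a `z`-filter `P` such that `Z₁ ∪ Z₂ ∉ P` whenever `Z₁` and `Z₂` are
zero sets not in `P`. -/
structure IsPrimeZFilter {X : Type*} [TopologicalSpace X] (P : Set (Set X)) : Prop
    extends IsZFilter P where
  union_notMem : ∀ Z₁ ∈ zeroSets X \ P, ∀ Z₂ ∈ zeroSets X \ P, Z₁ ∪ Z₂ ∉ P

/-- `A^{(∞)} = ⋂_{n ≥ 1} A^{(n)}`, where `A^{(1)}` is the set of limit points of the subspace `A`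
and `A^{(n+1)}` is the set of limit points of the subspace `A^{(n)}`. -/
def derivedLevelInfty {X : Type*} [TopologicalSpace X] (A : Set X) : Set X :=
  ⋂ n : ℕ, CantorBendixson.iteratedDerivedSet A ((n + 1 : ℕ) : Ordinal)

/-- `(Q_α : α < κ)` is a well-ordered decreasing chain of order type `κ` of prime `z`-filters
on `X`: it is strictly decreasing with respect to inclusion. -/
def IsDecreasingPrimeZChain {X : Type*} [TopologicalSpace X] {κ : Ordinal}
    (Q : Set.Iio κ → Set (Set X)) : Prop :=
  (∀ α, IsPrimeZFilter (Q α)) ∧ ∀ α β, α < β → Q β ⊂ Q α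

/-- `(Q_α : α < κ)` is a well-ordered increasing chain of order type `κ` of prime `z`-filters
on `X`: it is strictly increasing with respect to inclusion. -/
def IsIncreasingPrimeZChain {X : Type*} [TopologicalSpace X] {κ : Ordinal}
    (Q : Set.Iio κ → Set (Set X)) : Prop :=
  (∀ α, IsPrimeZFilter (Q α)) ∧ ∀ α β, α < β → Q α ⊂ Q β

open Filter Topology Set

section PrimeZFilter

variable {X : Type*}

/-! Zero sets are the closed sets, and an ultrafilter limit of prime `z`-filters is prime. If points
`x k → p` carry chains of `n + 1` prime `z`-filters, limits along a free ultrafilter give such a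
chain at `p`, and the fixed filter at `p` goes on top (`exists_finite_chain`). A point lying in
every finite derived set is thus a limit of points carrying chains of any prescribed finite lengths,
and a suitable ultraproduct of these chains contains any linear order of size at most the continuum
(`exists_ultraproduct_chain`). Inclusions stay strict in the limit because local witnesses glue
(`zLimit_ssubset`). The ordinal 𝔠 and its dual give the two chains. -/

theorem mem_zeroSets_iff_isClosed [MetricSpace X] {Z : Set X} : Z ∈ zeroSets X ↔ IsClosed Z := by
  constructor
  · rintro ⟨f, rfl⟩
    exact isClosed_eq f.continuous continuous_const
  · intro hZ
    rcases Z.eq_empty_or_nonempty with rfl | hne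
    · exact ⟨ContinuousMap.const X 1, by ext; simp⟩
    · refine ⟨⟨fun x => Metric.infDist x Z, Metric.continuous_infDist_pt Z⟩, ?_⟩
      ext x
      exact hZ.mem_iff_infDist_zero hne

variable [MetricSpace X] {P : Set (Set X)} {Z W : Set X}

theorem IsZFilter.isClosed (hP : IsZFilter P) (hZ : Z ∈ P) : IsClosed Z :=
  mem_zeroSets_iff_isClosed.1 (hP.proper.1 hZ)

theorem IsZFilter.mono (hP : IsZFilter P) (hZ : Z ∈ P) (hW : IsClosed W) (h : Z ⊆ W) : W ∈ P :=
  hP.superset_mem Z hZ W (mem_zeroSets_iff_isClosed.2 hW) h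

theorem IsZFilter.univ_mem (hP : IsZFilter P) : univ ∈ P :=
  hP.nonempty.elim fun _ hZ => hP.mono hZ isClosed_univ (subset_univ _)

theorem IsZFilter.empty_notMem (hP : IsZFilter P) : ∅ ∉ P := fun h =>
  hP.proper.2 fun Z hZ => hP.superset_mem ∅ h Z hZ (empty_subset Z)

theorem IsPrimeZFilter.mem_or_mem (hP : IsPrimeZFilter P) (hZ : IsClosed Z) (hW : IsClosed W)
    (h : Z ∪ W ∈ P) : Z ∈ P ∨ W ∈ P := by
  by_contra! hn
  exact hP.union_notMem Z ⟨mem_zeroSets_iff_isClosed.2 hZ, hn.1⟩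
    W ⟨mem_zeroSets_iff_isClosed.2 hW, hn.2⟩ h

/-- In a metric space, prime `z`-filters are the prime filters of the lattice of closed sets. -/
theorem IsPrimeZFilter.of_isClosed (closed : ∀ Z ∈ P, IsClosed Z) (univ_mem : univ ∈ P)
    (empty_notMem : ∅ ∉ P) (inter_mem : ∀ Z ∈ P, ∀ W ∈ P, Z ∩ W ∈ P)
    (mono : ∀ Z ∈ P, ∀ W, IsClosed W → Z ⊆ W → W ∈ P)
    (mem_or_mem : ∀ Z W, IsClosed Z → IsClosed W → Z ∪ W ∈ P → Z ∈ P ∨ W ∈ P) :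
    IsPrimeZFilter P where
  nonempty := ⟨univ, univ_mem⟩
  proper := ⟨fun Z hZ => mem_zeroSets_iff_isClosed.2 (closed Z hZ),
    fun h => empty_notMem (h (mem_zeroSets_iff_isClosed.2 isClosed_empty))⟩
  inter_mem := inter_mem
  superset_mem Z hZ W hW := mono Z hZ W (mem_zeroSets_iff_isClosed.1 hW)
  union_notMem Z hZ W hW h := (mem_or_mem Z W (mem_zeroSets_iff_isClosed.1 hZ.1)
    (mem_zeroSets_iff_isClosed.1 hW.1) h).elim hZ.2 hW.2

theorem isPrimeZFilter_closed_mem (x : X) : IsPrimeZFilter {Z : Set X | IsClosed Z ∧ x ∈ Z} :=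
  .of_isClosed (fun _ h => h.1) ⟨isClosed_univ, mem_univ x⟩ (fun h => h.2)
    (fun _ hZ _ hW => ⟨hZ.1.inter hW.1, hZ.2, hW.2⟩) (fun _ hZ _ hW h => ⟨hW, h hZ.2⟩)
    (fun _ _ hZ hW h => h.2.imp (fun hx => ⟨hZ, hx⟩) (fun hx => ⟨hW, hx⟩))

/-- A `z`-filter converges to `x` if it contains all closed neighbourhoods of `x`. -/
def ZConverges (P : Set (Set X)) (x : X) : Prop :=
  ∀ Z ∈ 𝓝 x, IsClosed Z → Z ∈ P

theorem ZConverges.mem {x : X} (h : ZConverges P x) (hP : IsZFilter P) (hZ : Z ∈ P) : x ∈ Z := by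
  by_contra hx
  obtain ⟨V, ⟨hV, hVc⟩, hVZ⟩ :=
    (closed_nhds_basis x).mem_iff.1 ((hP.isClosed hZ).isOpen_compl.mem_nhds hx)
  refine hP.empty_notMem ?_
  have := hP.inter_mem V (h V hV hVc) Z hZ
  rwa [(disjoint_left.2 fun y hy hyZ => hVZ hy hyZ : Disjoint V Z).inter_eq] at this

/-- The limit of a family of `z`-filters along a filter on the index set. -/
def zLimit {ι : Type*} (U : Filter ι) (P : ι → Set (Set X)) : Set (Set X) :=
  {Z | ∀ᶠ n in U, Z ∈ P n}

theorem isPrimeZFilter_zLimit {ι : Type*} (U : Ultrafilter ι) {P : ι → Set (Set X)}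
    (hP : ∀ n, IsPrimeZFilter (P n)) : IsPrimeZFilter (zLimit (U : Filter ι) P) := by
  refine .of_isClosed ?_ ?_ ?_ ?_ ?_ ?_
  · intro Z hZ
    obtain ⟨n, hn⟩ := Eventually.exists (show ∀ᶠ n in (U : Filter ι), Z ∈ P n from hZ)
    exact (hP n).isClosed hn
  · exact Eventually.of_forall fun n => (hP n).univ_mem
  · intro h
    obtain ⟨n, hn⟩ := Eventually.exists (show ∀ᶠ n in (U : Filter ι), ∅ ∈ P n from h)
    exact (hP n).empty_notMem hn
  · intro Z hZ W hW
    exact Eventually.mp hZ (Eventually.mono hW fun n hW hZ => (hP n).inter_mem Z hZ W hW)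
  · intro Z hZ W hW h
    exact Eventually.mono hZ fun n hZ => (hP n).mono hZ hW h
  · intro Z W hZ hW h
    exact Ultrafilter.eventually_or.1
      (Eventually.mono h fun n h => (hP n).mem_or_mem hZ hW h)

end PrimeZFilter

section Separated

variable {X : Type*} [MetricSpace X]

/-- Points chosen from sets accumulating at `p` can be taken to converge to `p` and to have closed
neighbourhoods such that closed subsets of these can be glued together. -/
theorem exists_separated_seq {A : ℕ → Set X} {p : X} (hA : ∀ n, p ∈ derivedSet (A n)) :
    ∃ (x : ℕ → X) (B : ℕ → Set X), (∀ n, x n ∈ A n) ∧ (∀ n, x n ≠ p) ∧ (∀ n, B n ∈ 𝓝 (x n)) ∧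
      (∀ n, IsClosed (B n)) ∧ Tendsto x atTop (𝓝 p) ∧
      ∀ Z : ℕ → Set X, (∀ n, IsClosed (Z n)) → (∀ n, Z n ⊆ B n) →
        ∃ W, IsClosed W ∧ ∀ n, W ∩ B n = Z n := by
  have key : ∀ n (r : ℝ), ∃ y, 0 < r → y ∈ A n ∧ y ≠ p ∧ dist y p < r := by
    intro n r
    by_cases hr : 0 < r
    · obtain ⟨y, ⟨hy, hyA⟩, hyp⟩ := accPt_iff_nhds.1 (hA n) _ (Metric.ball_mem_nhds p hr)
      exact ⟨y, fun _ => ⟨hyA, hyp, hy⟩⟩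
    · exact ⟨p, fun h => absurd h hr⟩
  choose g hg using key
  -- Each point is chosen within half the previous distance to `p`.
  let r : ℕ → ℝ := fun n => Nat.rec 1 (fun n rn => dist (g n rn) p / 2) n
  let x : ℕ → X := fun n => g n (r n)
  have hrs : ∀ n, r (n + 1) = dist (x n) p / 2 := fun n => rfl
  have hr : ∀ n, 0 < r n := by
    intro n
    induction n with
    | zero => exact one_pos
    | succ n ih => rw [hrs]; exact half_pos (dist_pos.2 (hg n _ ih).2.1)
  have hxA : ∀ n, x n ∈ A n := fun n => (hg n _ (hr n)).1
  have hxp : ∀ n, x n ≠ p := fun n => (hg n _ (hr n)).2.1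
  have hxr : ∀ n, dist (x n) p < r n := fun n => (hg n _ (hr n)).2.2
  have hd : ∀ n, 0 < dist (x n) p := fun n => dist_pos.2 (hxp n)
  have hanti : Antitone r := antitone_nat_of_succ_le fun n => by
    have := hrs n; have := hxr n; have := hr n; linarith
  have hpow : ∀ n, r n ≤ (1 / 2 : ℝ) ^ n := by
    intro n
    induction n with
    | zero => exact le_of_eq (pow_zero _).symm
    | succ n ih => have := hrs n; have := hxr n; rw [pow_succ]; linarith
  have hr0 : Tendsto r atTop (𝓝 0) :=
    squeeze_zero (fun n => (hr n).le) hpow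
      (tendsto_pow_atTop_nhds_zero_of_lt_one (by norm_num) (by norm_num))
  -- With a quarter of the distance as radius, the balls lie in disjoint shells around `p`, since
  -- 5/4 · 1/2 < 3/4.
  let B : ℕ → Set X := fun n => Metric.closedBall (x n) (dist (x n) p / 4)
  have hBp : ∀ n, ∀ y ∈ B n, 3 / 4 * dist (x n) p ≤ dist y p ∧ dist y p ≤ 5 / 4 * dist (x n) p := by
    intro n y hy
    have h1 : dist y (x n) ≤ dist (x n) p / 4 := hy
    have h2 := dist_triangle y (x n) p
    have h3 := dist_triangle_left (x n) p y
    constructor <;> linarith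
  have hlt : ∀ m n, m < n → ∀ y ∈ B m, ∀ z ∈ B n, dist z p < dist y p := by
    intro m n hmn y hy z hz
    have h1 := (hBp m y hy).1
    have h2 := (hBp n z hz).2
    have h3 : r n ≤ r (m + 1) := hanti hmn
    have h4 := hrs m
    have h5 := hxr n
    have h6 := hd m
    linarith
  refine ⟨x, B, hxA, hxp, fun n => Metric.closedBall_mem_nhds _ (by have := hd n; positivity),
    fun n => Metric.isClosed_closedBall, ?_, ?_⟩
  · exact tendsto_iff_dist_tendsto_zero.2
      (squeeze_zero (fun _ => dist_nonneg) (fun n => (hxr n).le) hr0)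
  · intro Z hZ hZB
    -- This set is `{p}` together with all the `Z n`, written so that closedness is evident; the
    -- ball of radius `2 * r N` contains every `Z n` with `n ≥ N`.
    refine ⟨⋂ N, (⋃ n ∈ Finset.range N, Z n) ∪ Metric.closedBall p (2 * r N), ?_, fun n => ?_⟩
    · exact isClosed_iInter fun N =>
        (isClosed_biUnion_finset fun n _ => hZ n).union Metric.isClosed_closedBall
    · ext y
      simp only [mem_inter_iff, mem_iInter, mem_union, mem_iUnion, Finset.mem_range, exists_prop,
        Metric.mem_closedBall]
      constructor
      · rintro ⟨hy, hyB⟩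
        have hyp : 0 < dist y p := by have := hd n; have := (hBp n y hyB).1; linarith
        obtain ⟨N, hN⟩ := (hr0.eventually (gt_mem_nhds (half_pos hyp))).exists
        rcases hy N with ⟨m, -, hm⟩ | h
        · rcases lt_trichotomy m n with h | rfl | h
          · exact absurd (hlt m n h y (hZB m hm) y hyB) (lt_irrefl _)
          · exact hm
          · exact absurd (hlt n m h y hyB y (hZB m hm)) (lt_irrefl _)
        · linarith
      · intro hy
        refine ⟨fun N => ?_, hZB n hy⟩
        rcases lt_or_ge n N with h | h
        · exact Or.inl ⟨n, h, hy⟩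
        · right
          have h1 := (hBp n y (hZB n hy)).2
          have h2 := hanti h
          have h3 := hxr n
          have h4 := hr n
          linarith

/-- Convergence to `x n` makes membership depend only on the trace on `B n`. Sets separating `P n`
from `Q n` can thus be cut down to `B n` and glued into one closed set separating the limits. -/
theorem zLimit_ssubset {x : ℕ → X} {B : ℕ → Set X} (hB : ∀ n, B n ∈ 𝓝 (x n))
    (hBc : ∀ n, IsClosed (B n))
    (hglue : ∀ Z : ℕ → Set X, (∀ n, IsClosed (Z n)) → (∀ n, Z n ⊆ B n) →
      ∃ W, IsClosed W ∧ ∀ n, W ∩ B n = Z n)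
    {U : Filter ℕ} [U.NeBot] {P Q : ℕ → Set (Set X)} (hP : ∀ n, IsZFilter (P n))
    (hQ : ∀ n, IsZFilter (Q n)) (hPx : ∀ n, ZConverges (P n) (x n))
    (hQx : ∀ n, ZConverges (Q n) (x n)) (h : ∀ᶠ n in U, Q n ⊂ P n) :
    zLimit U Q ⊂ zLimit U P := by
  refine ⟨fun Z hZ => Eventually.mp hZ (h.mono fun n hn hZ => hn.1 hZ), fun hsub => ?_⟩
  have key : ∀ n, ∃ Z, IsClosed Z ∧ Z ⊆ B n ∧ (Q n ⊂ P n → Z ∈ P n ∧ Z ∉ Q n) := by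
    intro n
    by_cases hn : Q n ⊂ P n
    · obtain ⟨Z, hZP, hZQ⟩ := exists_of_ssubset hn
      have hmem := (hP n).inter_mem Z hZP (B n) (hPx n _ (hB n) (hBc n))
      exact ⟨Z ∩ B n, (hP n).isClosed hmem, inter_subset_right, fun _ => ⟨hmem, fun hQ' =>
        hZQ ((hQ n).mono hQ' ((hP n).isClosed hZP) inter_subset_left)⟩⟩
    · exact ⟨∅, isClosed_empty, empty_subset _, fun h => absurd h hn⟩
  choose Z hZc hZB hZ using key
  obtain ⟨W, hWc, hW⟩ := hglue Z hZc hZB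
  have hWP : W ∈ zLimit U P := h.mono fun n hn =>
    (hP n).mono (hZ n hn).1 hWc (by rw [← hW n]; exact inter_subset_left)
  have hWQ : ∀ᶠ n in U, W ∈ Q n := hsub hWP
  obtain ⟨n, hn, hWn⟩ := (h.and hWQ).exists
  refine (hZ n hn).2 ?_
  rw [← hW n]
  exact (hQ n).inter_mem W hWn (B n) (hQx n _ (hB n) (hBc n))

/-- A point of the `n`-th derived set is the limit of a chain of `n + 1` prime `z`-filters. -/
theorem exists_finite_chain {A : Set X} (hA : IsClosed A) (n : ℕ) :
    ∀ x ∈ CantorBendixson.iteratedDerivedSet A (n : Ordinal), ∃ P : ℕ → Set (Set X),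
      (∀ i, IsPrimeZFilter (P i) ∧ A ∈ P i ∧ ZConverges (P i) x) ∧
      ∀ i j, i < j → j ≤ n → P j ⊂ P i := by
  induction n with
  | zero =>
    intro x hx
    rw [Nat.cast_zero, CantorBendixson.iteratedDerivedSet_zero] at hx
    refine ⟨fun _ => {Z | IsClosed Z ∧ x ∈ Z}, fun _ => ⟨isPrimeZFilter_closed_mem x, ⟨hA, hx⟩,
      fun Z hZ hZc => ⟨hZc, mem_of_mem_nhds hZ⟩⟩, fun i j hij hj => by omega⟩
  | succ n ih =>
    intro p hp
    have hpA : p ∈ A := by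
      have := CantorBendixson.iteratedDerivedSet_antitone A (zero_le : (0 : Ordinal) ≤ _) hp
      rwa [CantorBendixson.iteratedDerivedSet_zero] at this
    rw [Nat.cast_succ, CantorBendixson.iteratedDerivedSet_succ] at hp
    obtain ⟨x, B, hxA, hxp, hB, hBc, hlim, hglue⟩ :=
      exists_separated_seq (A := fun _ => CantorBendixson.iteratedDerivedSet A (n : Ordinal))
        (fun _ => hp.1)
    choose P hP hPs using fun k => ih (x k) (hxA k)
    let U : Ultrafilter ℕ := hyperfilter ℕ
    have hlim' : Tendsto x U (𝓝 p) := hlim.mono_left Nat.hyperfilter_le_atTop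
    let Q : ℕ → Set (Set X) := fun i =>
      Nat.casesOn i {Z | IsClosed Z ∧ p ∈ Z} fun i => zLimit U fun k => P k i
    have hQ : ∀ i, IsPrimeZFilter (Q i) ∧ A ∈ Q i ∧ ZConverges (Q i) p := by
      rintro (_ | i)
      · exact ⟨isPrimeZFilter_closed_mem p, ⟨hA, hpA⟩,
          fun Z hZ hZc => ⟨hZc, mem_of_mem_nhds hZ⟩⟩
      · refine ⟨isPrimeZFilter_zLimit U fun k => (hP k i).1,
          Eventually.of_forall fun k => (hP k i).2.1, fun Z hZ hZc => ?_⟩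
        have : ∀ᶠ k in (U : Filter ℕ), Z ∈ 𝓝 (x k) := hlim'.eventually (eventually_mem_nhds_iff.2 hZ)
        exact this.mono fun k hk => (hP k i).2.2 Z hk hZc
    refine ⟨Q, hQ, fun i j hij hj => ?_⟩
    obtain ⟨j, rfl⟩ : ∃ j', j = j' + 1 := ⟨j - 1, by omega⟩
    rcases i with _ | i
    · refine ⟨fun Z hZ => ⟨(hQ (j + 1)).1.isClosed hZ,
        (hQ (j + 1)).2.2.mem (hQ (j + 1)).1.toIsZFilter hZ⟩,
        fun hsub => ?_⟩
      -- `{p}` separates the top filter from the others: members of `P k j` contain `x k ≠ p`.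
      have h : ∀ᶠ k in (U : Filter ℕ), {p} ∈ P k j :=
        hsub (show {p} ∈ Q 0 from ⟨isClosed_singleton, mem_singleton p⟩)
      obtain ⟨k, hk⟩ := h.exists
      exact hxp k ((hP k j).2.2.mem (hP k j).1.toIsZFilter hk)
    · exact zLimit_ssubset hB hBc hglue (fun k => (hP k i).1.toIsZFilter)
        (fun k => (hP k j).1.toIsZFilter) (fun k => (hP k i).2.2) (fun k => (hP k j).2.2)
        (Eventually.of_forall fun k => hPs k i j (by omega) (by omega))

end Separated

section Ultraproduct

open Cardinal

/-- An order of cardinality at most the continuum embeds in an ultraproduct of finite orders. -/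
theorem exists_ultraproduct_chain {L : Type*} [LinearOrder L] (φ : L → ℕ → Bool)
    (hφ : Function.Injective φ) :
    ∃ (U : Ultrafilter ℕ) (f : L → ℕ → ℕ) (b : ℕ → ℕ), (∀ a n, f a n ≤ b n) ∧
      ∀ a c, a < c → ∀ᶠ n in (U : Filter ℕ), f a n < f c n := by
  classical
  -- Enumerate all functions from binary words of a fixed length to ℕ; `f a n` applies the `n`-th
  -- one to an initial segment of `φ a`. Having finitely many words bounds `f a n` uniformly in `a`.
  obtain ⟨e, he⟩ := exists_surjective_nat (Σ l : ℕ, (Fin l → Bool) → ℕ)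
  let f : L → ℕ → ℕ := fun a n => (e n).2 fun i => φ a i
  have hf : ∀ s : Finset L, ∃ n, StrictMonoOn (fun a => f a n) s := by
    intro s
    obtain ⟨l, hl⟩ : ∃ l : ℕ, ∀ a ∈ s, ∀ c ∈ s, (∀ i < l, φ a i = φ c i) → a = c := by
      have h : ∀ q : L × L, ∃ i, q.1 ≠ q.2 → φ q.1 i ≠ φ q.2 i := by
        intro q
        by_cases hq : q.1 = q.2
        · exact ⟨0, fun h => absurd hq h⟩
        · obtain ⟨i, hi⟩ := Function.ne_iff.1 (hφ.ne hq)
          exact ⟨i, fun _ => hi⟩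
      choose d hd using h
      refine ⟨(s ×ˢ s).sup d + 1, fun a ha c hc h => ?_⟩
      by_contra hac
      exact hd (a, c) hac (h _ (Nat.lt_succ_of_le
        (Finset.le_sup (f := d) (Finset.mk_mem_product ha hc))))
    -- Words of length `l` separate `s`, so the rank in `s` can be read off the word.
    obtain ⟨n, hn⟩ := he ⟨l, fun σ =>
      (s.filter fun c => ∃ a ∈ s, (∀ i : Fin l, φ a i = σ i) ∧ c < a).card⟩
    have hfn : ∀ a ∈ s, f a n = (s.filter fun c => c < a).card := by
      intro a ha
      refine (congrArg (fun q : Σ l : ℕ, (Fin l → Bool) → ℕ => q.2 fun i => φ a i) hn).trans ?_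
      refine congrArg Finset.card ?_
      refine Finset.filter_congr fun c _ => ⟨?_, fun h => ⟨a, ha, fun _ => rfl, h⟩⟩
      rintro ⟨a', ha', h, hc⟩
      rwa [← hl a' ha' a ha fun i hi => h ⟨i, hi⟩]
    refine ⟨n, fun a ha c hc hac => ?_⟩
    simp only [hfn a ha, hfn c hc]
    refine Finset.card_lt_card ⟨fun d hd => ?_, fun hsub => ?_⟩
    · rw [Finset.mem_filter] at hd ⊢
      exact ⟨hd.1, hd.2.trans hac⟩
    · exact lt_irrefl a (Finset.mem_filter.1 (hsub (Finset.mem_filter.2 ⟨ha, hac⟩))).2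
  let F : Filter ℕ := ⨅ s : Finset L, 𝓟 {n | StrictMonoOn (fun a => f a n) s}
  have hF : F.NeBot := by
    refine iInf_neBot_of_directed (fun s t => ⟨s ∪ t, ?_, ?_⟩) fun s =>
      principal_neBot_iff.2 (hf s)
    · exact principal_mono.2 fun n (hn : StrictMonoOn _ _) =>
        hn.mono (Finset.coe_subset.2 Finset.subset_union_left)
    · exact principal_mono.2 fun n (hn : StrictMonoOn _ _) =>
        hn.mono (Finset.coe_subset.2 Finset.subset_union_right)
  refine ⟨Ultrafilter.of F, f, fun n => Finset.univ.sup (e n).2,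
    fun a n => Finset.le_sup (f := (e n).2) (Finset.mem_univ _), fun a c hac => ?_⟩
  have hmem : {n | StrictMonoOn (fun a => f a n) (({a, c} : Finset L) : Set L)} ∈ F :=
    mem_iInf_of_mem {a, c} (mem_principal_self _)
  filter_upwards [Ultrafilter.of_le F hmem] with n hn
  exact hn (by simp) (by simp) hac

/-- If all finite derived sets of `A` have a common point, then every linear order of cardinality
at most the continuum is realised, reversed, by a chain of prime `z`-filters containing `A`. -/
theorem exists_primeZFilter_chain {X : Type*} [MetricSpace X] {A : Set X} (hA : IsClosed A)
    (hinf : (derivedLevelInfty A).Nonempty) {L : Type*} [LinearOrder L] (φ : L → ℕ → Bool)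
    (hφ : Function.Injective φ) :
    ∃ Q : L → Set (Set X), (∀ a, IsPrimeZFilter (Q a) ∧ A ∈ Q a) ∧
      ∀ a c, a < c → Q c ⊂ Q a := by
  obtain ⟨p, hp⟩ := hinf
  obtain ⟨U, f, b, hfb, hf⟩ := exists_ultraproduct_chain φ hφ
  -- Level `b n + 1` makes `p` an accumulation point of level `b n`, whose points carry chains
  -- indexed by `0, …, b n`.
  have hacc : ∀ n, p ∈ derivedSet (CantorBendixson.iteratedDerivedSet A (b n : Ordinal)) := by
    intro n
    have h := mem_iInter.1 hp (b n)
    rw [Nat.cast_succ, CantorBendixson.iteratedDerivedSet_succ] at h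
    exact h.1
  obtain ⟨x, B, hxA, -, hB, hBc, -, hglue⟩ := exists_separated_seq hacc
  choose P hP hPs using fun n => exists_finite_chain hA (b n) (x n) (hxA n)
  refine ⟨fun a => zLimit U fun n => P n (f a n), fun a =>
    ⟨isPrimeZFilter_zLimit U fun n => (hP n _).1, Eventually.of_forall fun n => (hP n _).2.1⟩,
    fun a c hac => ?_⟩
  exact zLimit_ssubset hB hBc hglue (fun n => (hP n _).1.toIsZFilter)
    (fun n => (hP n _).1.toIsZFilter) (fun n => (hP n _).2.2) (fun n => (hP n _).2.2)
    ((hf a c hac).mono fun n hn => hPs n _ _ hn (hfb c n))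

theorem exists_injective_Iio_ord_continuum :
    ∃ φ : Set.Iio (continuum.{0}.ord) → ℕ → Bool, Function.Injective φ := by
  have h : lift.{0} #(Set.Iio (continuum.{0}.ord)) ≤ lift.{1} #(ℕ → Bool) := by
    simp [mk_Iio_ordinal]
  obtain ⟨g⟩ := lift_mk_le'.1 h
  exact ⟨g, g.injective⟩

end Ultraproduct

theorem mainTheorem9 (Δ : Set ℝ) (hcount : Δ.Countable) (hcomp : IsCompact Δ)
    (hinf : (derivedLevelInfty Δ).Nonempty) :
    (∃ Q : Set.Iio (Cardinal.continuum.{0}.ord) → Set (Set ℝ),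
      IsDecreasingPrimeZChain Q ∧ ∀ α, Δ ∈ Q α) ∧
    (∃ Q : Set.Iio (Cardinal.continuum.{0}.ord) → Set (Set ℝ),
      IsIncreasingPrimeZChain Q ∧ ∀ α, Δ ∈ Q α) := by
  obtain ⟨φ, hφ⟩ := exists_injective_Iio_ord_continuum
  constructor
  · obtain ⟨Q, hQ, hlt⟩ := exists_primeZFilter_chain hcomp.isClosed hinf φ hφ
    exact ⟨Q, ⟨fun α => (hQ α).1, hlt⟩, fun α => (hQ α).2⟩
  · obtain ⟨Q, hQ, hlt⟩ := exists_primeZFilter_chain hcomp.isClosed hinf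
      (L := (Set.Iio (Cardinal.continuum.{0}.ord))ᵒᵈ) (fun α => φ (OrderDual.ofDual α))
      (hφ.comp OrderDual.ofDual.injective)
    exact ⟨fun α => Q (OrderDual.toDual α), ⟨fun α => (hQ _).1,
      fun α β h => hlt _ _ (OrderDual.toDual_lt_toDual.2 h)⟩, fun α => (hQ _).2⟩
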